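/- **Lemma 3.7.** Let $(M,\langle\cdot,\cdot\rangle,I)$ be an almost Hermitian manifold of real dimension $2n$: $M$ is a smooth manifold, $\langle\cdot,\cdot\rangle$ is a Riemannian metric, and $I$ is a smooth almost complex structure with $\langle IX,IY\rangle=\langle X,Y\rangle$. Let $\nabla$ be the Levi-Civita connection, let $\widetilde\nabla$ be the minimal $\mathrm U(n)$-connection and let $\xi=\widetilde\nabla-\nabla$ be the intrinsic torsion; that is, $\widetilde\nabla$ is the metric connection with $\widetilde\nabla I=0$ such that, for every $X$, the endomorphism $\xi_X=\widetilde\nabla_X-\nabla_X$ lies in the orthogonal complement of $\mathfrak u(n)$ in $\mathfrak{so}(2n)$. Put $$R_{X,Y}=\nabla_{[X,Y]}-[\nabla_X,\nabla_Y],\qquad \mathrm{Ric}^*(X,Y)=\sum_{i=1}^{2n}\langle R_{X,e_i}IY,Ie_i\rangle,$$ where $e_1,\dots,e_{2n}$ is an orthonormal basis of the tangent space, and let $$\mathrm{Ric}^*_{AH}(X,Y)=\tfrac12\bigl(\mathrm{Ric}^*(X,Y)-\mathrm{Ric}^*(IX,IY)\bigr)$$ be the anti-Hermitian part of $\mathrm{Ric}^*$.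 Let $I\xi$ be the tensor $(I\xi)_XY=I(\xi_XY)$. Then, at every point of $M$, for all tangent vectors $X,Y$ and every orthonormal basis $e_1,\dots,e_{2n}$ of the tangent space, $$\mathrm{Ric}^*_{AH}(X,Y)=\sum_{i=1}^{2n}\langle(\widetilde\nabla_{e_i}\xi)_{Ie_i}IX,Y\rangle-\sum_{i=1}^{2n}\langle\xi_{I\xi_{e_i}e_i}IX,Y\rangle=-\sum_{i=1}^{2n}\langle(\nabla_{e_i}I\xi)_{Ie_i}X,Y\rangle.$$ -/

import Mathlib

open Bundle Manifold
open scoped ContDiff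

noncomputable section

namespace AlmostHermitian

section

variable {E : Type*} [NormedAddCommGroup E] [NormedSpace ℝ E] [FiniteDimensional ℝ E]
  {M : Type*} [TopologicalSpace M] [ChartedSpace E M] [IsManifold 𝓘(ℝ, E) ∞ M]

/-! ### Metrics, almost complex structures and connections

`M` is a smooth manifold without boundary, with tangent space `TangentSpace 𝓘(ℝ, E) x` at `x`.
For a covariant derivative `D` on the tangent bundle, `D Y x u` is `(∇_u Y)(x)`. -/

/-- `J` is a smooth almost complex structure, orthogonal for the Riemannian metric `g`:
`(g, J)` is an almost Hermitian structure on `M`. -/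
structure IsAlmostHermitian
    (g : ContMDiffRiemannianMetric 𝓘(ℝ, E) ∞ E (fun x : M => TangentSpace 𝓘(ℝ, E) x))
    (J : ∀ x : M, TangentSpace 𝓘(ℝ, E) x →L[ℝ] TangentSpace 𝓘(ℝ, E) x) : Prop where
  smooth : ContMDiff 𝓘(ℝ, E) (𝓘(ℝ, E).prod 𝓘(ℝ, E →L[ℝ] E)) ∞
    (fun x => TotalSpace.mk' (E →L[ℝ] E)
      (E := fun x : M => TangentSpace 𝓘(ℝ, E) x →L[ℝ] TangentSpace 𝓘(ℝ, E) x) x (J x))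
  sq : ∀ (x : M) (u : TangentSpace 𝓘(ℝ, E) x), J x (J x u) = -u
  orthogonal : ∀ (x : M) (u v : TangentSpace 𝓘(ℝ, E) x),
    g.inner x (J x u) (J x v) = g.inner x u v

/-- The connection `D` is metric: `d⟨Y, Z⟩(u) = ⟨∇_u Y, Z⟩ + ⟨Y, ∇_u Z⟩`. -/
def IsMetric (g : ContMDiffRiemannianMetric 𝓘(ℝ, E) ∞ E (fun x : M => TangentSpace 𝓘(ℝ, E) x))
    (D : CovariantDerivative 𝓘(ℝ, E) E (TangentSpace 𝓘(ℝ, E) : M → Type _)) : Prop :=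
  ∀ (x : M) (Y Z : ∀ y : M, TangentSpace 𝓘(ℝ, E) y) (u : TangentSpace 𝓘(ℝ, E) x),
    MDiffAt (T% Y) x → MDiffAt (T% Z) x →
      d% (fun y => g.inner y (Y y) (Z y)) x u
        = g.inner x (D Y x u) (Z x) + g.inner x (Y x) (D Z x u)

/-- `D` is the Levi-Civita connection of `g`: the smooth, metric, torsion-free connection. -/
structure IsLeviCivita
    (g : ContMDiffRiemannianMetric 𝓘(ℝ, E) ∞ E (fun x : M => TangentSpace 𝓘(ℝ, E) x))
    (D : CovariantDerivative 𝓘(ℝ, E) E (TangentSpace 𝓘(ℝ, E) : M → Type _)) : Prop where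
  smooth : D.ContMDiffCovariantDerivative ∞
  metric : IsMetric g D
  torsion_free : haveI := FiniteDimensional.complete ℝ E; D.torsion = 0

/-- The difference tensor `ξ_X Y = ∇̃_X Y - ∇_X Y` of two connections `D = ∇` and `Dt = ∇̃`, as the
bilinear map `(X, Y) ↦ ξ_X Y`. -/
def differenceTensor (D Dt : CovariantDerivative 𝓘(ℝ, E) E (TangentSpace 𝓘(ℝ, E) : M → Type _))
    (x : M) : TangentSpace 𝓘(ℝ, E) x →ₗ[ℝ] TangentSpace 𝓘(ℝ, E) x →ₗ[ℝ] TangentSpace 𝓘(ℝ, E) x :=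
  ((ContinuousLinearMap.coeLM ℝ).comp (Dt.difference D x).toLinearMap).flip

/-- The Lie algebra `𝔰𝔬(T_x M)` of endomorphisms that are skew-symmetric for `g`. -/
def IsSkew (g : ContMDiffRiemannianMetric 𝓘(ℝ, E) ∞ E (fun x : M => TangentSpace 𝓘(ℝ, E) x))
    {x : M} (A : TangentSpace 𝓘(ℝ, E) x →ₗ[ℝ] TangentSpace 𝓘(ℝ, E) x) : Prop :=
  ∀ u v, g.inner x (A u) v = -g.inner x u (A v)

/-- `A` lies in the orthogonal complement of `𝔲(n)` in `𝔰𝔬(T_x M)`. Here `𝔲(n)` consists of the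
skew endomorphisms that commute with `J`, and `𝔰𝔬(T_x M)` has the inner product
`(A, B) ↦ -tr (A ∘ B)`. -/
def IsInUnitaryPerp
    (g : ContMDiffRiemannianMetric 𝓘(ℝ, E) ∞ E (fun x : M => TangentSpace 𝓘(ℝ, E) x))
    (J : ∀ x : M, TangentSpace 𝓘(ℝ, E) x →L[ℝ] TangentSpace 𝓘(ℝ, E) x)
    {x : M} (A : TangentSpace 𝓘(ℝ, E) x →ₗ[ℝ] TangentSpace 𝓘(ℝ, E) x) : Prop :=
  IsSkew g A ∧ ∀ B : TangentSpace 𝓘(ℝ, E) x →ₗ[ℝ] TangentSpace 𝓘(ℝ, E) x,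
    IsSkew g B → (∀ u, B (J x u) = J x (B u)) → LinearMap.trace ℝ _ (A ∘ₗ B) = 0

/-- `Dt` is the minimal `U(n)`-connection of the almost Hermitian structure `(g, J)` with Levi-Civita
connection `D`: the smooth connection `∇̃` that is metric, satisfies `∇̃ J = 0`, and whose
difference `ξ_X = ∇̃_X - ∇_X` takes values in the orthogonal complement of `𝔲(n)`. Then `ξ` is the
intrinsic torsion of the `U(n)`-structure. -/
structure IsMinimalUnitary
    (g : ContMDiffRiemannianMetric 𝓘(ℝ, E) ∞ E (fun x : M => TangentSpace 𝓘(ℝ, E) x))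
    (J : ∀ x : M, TangentSpace 𝓘(ℝ, E) x →L[ℝ] TangentSpace 𝓘(ℝ, E) x)
    (D Dt : CovariantDerivative 𝓘(ℝ, E) E (TangentSpace 𝓘(ℝ, E) : M → Type _)) : Prop where
  smooth : Dt.ContMDiffCovariantDerivative ∞
  metric : IsMetric g Dt
  parallel : ∀ (x : M) (Y : ∀ y : M, TangentSpace 𝓘(ℝ, E) y) (u : TangentSpace 𝓘(ℝ, E) x),
    MDiffAt (T% Y) x → Dt (fun y => J y (Y y)) x u = J x (Dt Y x u)
  perp : ∀ (x : M) (u : TangentSpace 𝓘(ℝ, E) x),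
    IsInUnitaryPerp g J (differenceTensor D Dt x u)

/-! ### Curvature and covariant derivatives of tensors

A tangent vector `u` at `x` is extended to the vector field `FiberBundle.extend E u`, which is smooth
near `x`. The expressions below are tensorial, so the choice of the extension is immaterial. -/

/-- The curvature operator `R_{X,Y} Z = ∇_{[X,Y]} Z - (∇_X ∇_Y Z - ∇_Y ∇_X Z)` of a connection
on vector fields. Note the sign convention. -/
def curvatureField (D : CovariantDerivative 𝓘(ℝ, E) E (TangentSpace 𝓘(ℝ, E) : M → Type _))
    (X Y Z : ∀ x : M, TangentSpace 𝓘(ℝ, E) x) (x : M) : TangentSpace 𝓘(ℝ, E) x :=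
  D Z x (VectorField.mlieBracket 𝓘(ℝ, E) X Y x)
    - (D (fun y => D Z y (Y y)) x (X x) - D (fun y => D Z y (X y)) x (Y x))

/-- The curvature tensor `R_{u,v} w` at the point `x`. -/
def curvature (D : CovariantDerivative 𝓘(ℝ, E) E (TangentSpace 𝓘(ℝ, E) : M → Type _))
    (x : M) (u v w : TangentSpace 𝓘(ℝ, E) x) : TangentSpace 𝓘(ℝ, E) x :=
  curvatureField D (FiberBundle.extend E u) (FiberBundle.extend E v) (FiberBundle.extend E w) x

/-- The covariant derivative of a tensor field `T`, `(X, Y) ↦ T_X Y`: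
`(∇_u T)_v w = ∇_u (T_V W) - T_{∇_u V} w - T_v (∇_u W)`, where the vector fields
`V`, `W` extend `v`, `w`. -/
def covDerivTensor (D : CovariantDerivative 𝓘(ℝ, E) E (TangentSpace 𝓘(ℝ, E) : M → Type _))
    (T : ∀ x : M, TangentSpace 𝓘(ℝ, E) x →ₗ[ℝ] TangentSpace 𝓘(ℝ, E) x →ₗ[ℝ]
      TangentSpace 𝓘(ℝ, E) x)
    (x : M) (u v w : TangentSpace 𝓘(ℝ, E) x) : TangentSpace 𝓘(ℝ, E) x :=
  D (fun y => T y (FiberBundle.extend E v y) (FiberBundle.extend E w y)) x u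
    - T x (D (FiberBundle.extend E v) x u) w
    - T x v (D (FiberBundle.extend E w) x u)

/-- The tensor field `J T`, `(J T)_X Y = J (T_X Y)`. -/
def compTensor (J : ∀ x : M, TangentSpace 𝓘(ℝ, E) x →L[ℝ] TangentSpace 𝓘(ℝ, E) x)
    (T : ∀ x : M, TangentSpace 𝓘(ℝ, E) x →ₗ[ℝ] TangentSpace 𝓘(ℝ, E) x →ₗ[ℝ]
      TangentSpace 𝓘(ℝ, E) x)
    (x : M) : TangentSpace 𝓘(ℝ, E) x →ₗ[ℝ] TangentSpace 𝓘(ℝ, E) x →ₗ[ℝ]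
      TangentSpace 𝓘(ℝ, E) x :=
  (T x).compr₂ (J x).toLinearMap

/-! ### The `*`-Ricci curvature -/

/-- `e` is an orthonormal basis of `T_x M`. -/
def IsOrthonormalBasis
    (g : ContMDiffRiemannianMetric 𝓘(ℝ, E) ∞ E (fun x : M => TangentSpace 𝓘(ℝ, E) x))
    {x : M} {m : ℕ} (e : Module.Basis (Fin m) ℝ (TangentSpace 𝓘(ℝ, E) x)) : Prop :=
  ∀ i j, g.inner x (e i) (e j) = if i = j then 1 else 0

/-- The `*`-Ricci curvature `Ric*(u, v) = ∑ i, ⟨R_{u, e_i} J v, J e_i⟩`, computed in the basis `e` of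
`T_x M` and with the connection `D`. It does not depend on the choice of the orthonormal
basis `e`. -/
def starRicci (g : ContMDiffRiemannianMetric 𝓘(ℝ, E) ∞ E (fun x : M => TangentSpace 𝓘(ℝ, E) x))
    (J : ∀ x : M, TangentSpace 𝓘(ℝ, E) x →L[ℝ] TangentSpace 𝓘(ℝ, E) x)
    (D : CovariantDerivative 𝓘(ℝ, E) E (TangentSpace 𝓘(ℝ, E) : M → Type _))
    {x : M} {m : ℕ} (e : Module.Basis (Fin m) ℝ (TangentSpace 𝓘(ℝ, E) x))
    (u v : TangentSpace 𝓘(ℝ, E) x) : ℝ :=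
  ∑ i, g.inner x (curvature D x u (e i) (J x v)) (J x (e i))

/-- The anti-Hermitian part `b_AH(u, v) = (b(u, v) - b(J u, J v)) / 2` of a bilinear form `b` on
`T_x M`, that is, its component with `b_AH(J u, J v) = -b_AH(u, v)`. -/
def antiHermitianPart (J : ∀ x : M, TangentSpace 𝓘(ℝ, E) x →L[ℝ] TangentSpace 𝓘(ℝ, E) x)
    {x : M} (b : TangentSpace 𝓘(ℝ, E) x → TangentSpace 𝓘(ℝ, E) x → ℝ)
    (u v : TangentSpace 𝓘(ℝ, E) x) : ℝ :=
  (b u v - b (J x u) (J x v)) / 2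

end

end AlmostHermitian

end

open AlmostHermitian

/-!
Let `R` be the curvature of `∇`. The first Bianchi identity and the symmetries of `R` and `J` give
`2 Ric*(u, v) = ∑ i, ⟨R_{e_i, J e_i} u, J v⟩`, so that `4 Ric*_AH(u, v)` is the sum of the
`⟨[R_{e_i, J e_i}, J] u, v⟩`: only the part of `R` that does not commute with `J` matters.

Write `∇ = ∇̃ - ξ`. The curvature of `∇̃` commutes with `J` because `∇̃ J = 0`, each `ξ_a`
anticommutes with `J` because it is orthogonal to `𝔲(n)`, and hence `[ξ_a, ξ_b]` commutes with `J`.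
What is left of the commutator is
`[R_{a, b}, J] = 2 ((∇̃_a ξ)_b - (∇̃_b ξ)_a + ξ_{ξ_a b} - ξ_{ξ_b a}) J`,
and the first formula follows by taking `b = J a` and summing over `a = e_i`. For the second,
`(∇_a Jξ)_b = J ((∇̃_a ξ)_b + ξ_{ξ_a b} + ξ_a ξ_b + ξ_b ξ_a)`, and the part symmetric in `a` and `b`
does not contribute to the sum over `a = e_i`, `b = J e_i`.

The curvature identities are identities in the Lie algebra of smooth vector fields, and they descend
to a tangent space because operators that are skew for the metric are tensorial.
-/

namespace AlmostHermitian

section OrthogonalBasis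

variable {k V W ι : Type*} [CommRing k] [AddCommGroup V] [Module k V] [AddCommGroup W] [Module k W]
  {g : V →ₗ[k] V →ₗ[k] k} {e : Module.Basis ι k V}

lemma repr_mul_of_iIsOrtho (he : g.IsOrthoᵢ e) (w : V) (i : ι) :
    e.repr w i * g (e i) (e i) = g w (e i) := by
  conv_rhs => rw [← e.linearCombination_repr w, Finsupp.linearCombination_apply, Finsupp.sum,
    map_sum, LinearMap.sum_apply]
  rw [Finset.sum_eq_single i
      (fun j _ hj => by rw [map_smul, LinearMap.smul_apply, he hj, smul_zero])
      (fun hi => by simp [Finsupp.notMem_support_iff.1 hi]),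
    map_smul, LinearMap.smul_apply, smul_eq_mul]

variable [Fintype ι] [DecidableEq ι]

lemma sum_apply_smul_of_orthonormal (he : ∀ i j, g (e i) (e j) = if i = j then 1 else 0) (v : V) :
    ∑ j, g v (e j) • e j = v := by
  have ho : g.IsOrthoᵢ e := fun i j hij => (he i j).trans (if_neg hij)
  have hrepr (j) : g v (e j) = e.repr v j := by
    rw [← repr_mul_of_iIsOrtho ho, he, if_pos rfl, mul_one]
  simp only [hrepr, e.sum_repr]

lemma sum_apply_skew_left (he : ∀ i j, g (e i) (e j) = if i = j then 1 else 0)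
    (hg : ∀ u v, g u v = g v u) {A : V →ₗ[k] V} (hA : ∀ u v, g (A u) v = -g u (A v))
    (b : V →ₗ[k] V →ₗ[k] W) : ∑ i, b (A (e i)) (e i) = -∑ i, b (e i) (A (e i)) := by
  have expand (i) : ∑ j, g (A (e i)) (e j) • e j = A (e i) := sum_apply_smul_of_orthonormal he _
  have hskew (i j) : g (A (e i)) (e j) = -g (A (e j)) (e i) := by rw [hA, hg]
  calc ∑ i, b (A (e i)) (e i)
      = ∑ i, ∑ j, g (A (e i)) (e j) • b (e j) (e i) := Finset.sum_congr rfl fun i _ => by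
        conv_lhs => rw [← expand i]
        simp only [map_sum, map_smul, LinearMap.sum_apply, LinearMap.smul_apply]
    _ = -∑ j, ∑ i, g (A (e j)) (e i) • b (e j) (e i) := by
        rw [Finset.sum_comm]
        simp only [← Finset.sum_neg_distrib, ← neg_smul, ← hskew]
    _ = -∑ i, b (e i) (A (e i)) := by
        simp only [← map_smul, ← map_sum, expand]

end OrthogonalBasis

section Trace

variable {K V : Type*} [Field K] [LinearOrder K] [IsStrictOrderedRing K] [AddCommGroup V]
  [Module K V] [FiniteDimensional K V] {g : V →ₗ[K] V →ₗ[K] K}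

lemma eq_zero_of_skew_of_trace_mul_self_eq_zero (hg : ∀ u v, g u v = g v u)
    (hpos : ∀ u, u ≠ 0 → 0 < g u u) {B : V →ₗ[K] V} (hB : ∀ u v, g (B u) v = -g u (B v))
    (htr : LinearMap.trace K V (B * B) = 0) : B = 0 := by
  have : Invertible (2 : K) := invertibleOfNonzero two_ne_zero
  obtain ⟨b, hb⟩ := LinearMap.BilinForm.exists_orthogonal_basis (B := g) ⟨hg⟩
  have hdiag (i) : b.repr (B (B (b i))) i * g (b i) (b i) = -g (B (b i)) (B (b i)) := by
    rw [repr_mul_of_iIsOrtho hb, hB]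
  have hneg (i) (hi : B (b i) ≠ 0) : b.repr (B (B (b i))) i < 0 :=
    neg_of_mul_neg_left ((hdiag i).trans_lt (neg_neg_of_pos (hpos _ hi))) (hpos _ (b.ne_zero i)).le
  have hnonpos (i) : b.repr (B (B (b i))) i ≤ 0 := by
    by_cases hi : B (b i) = 0
    · simp [hi]
    · exact (hneg i hi).le
  have hsum : ∑ i, b.repr (B (B (b i))) i = 0 := by
    rw [← htr, LinearMap.trace_eq_matrix_trace K b]
    simp [Matrix.trace, LinearMap.toMatrix_apply]
  refine b.ext fun i => by_contra fun hi => (hneg i hi).ne ?_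
  exact (Finset.sum_eq_zero_iff_of_nonpos fun i _ => hnonpos i).1 hsum i (Finset.mem_univ i)

/-- The test endomorphism is `A - J A J`, twice the part of `A` that commutes with `J`. -/
lemma complex_anticomm_of_trace_eq_zero (hg : ∀ u v, g u v = g v u)
    (hpos : ∀ u, u ≠ 0 → 0 < g u u) {J A : V →ₗ[K] V} (hsq : ∀ u, J (J u) = -u)
    (hJ : ∀ u v, g (J u) v = -g u (J v)) (hA : ∀ u v, g (A u) v = -g u (A v))
    (htr : ∀ B : V →ₗ[K] V, (∀ u v, g (B u) v = -g u (B v)) → (∀ u, B (J u) = J (B u)) →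
      LinearMap.trace K V (A ∘ₗ B) = 0) (u : V) :
    A (J u) = -J (A u) := by
  have hJJ : J * J = -1 := LinearMap.ext fun u => by simp [hsq]
  set B : V →ₗ[K] V := A - J * A * J with hB
  have hBskew (u v) : g (B u) v = -g u (B v) := by
    simp only [hB, LinearMap.sub_apply, Module.End.mul_apply, map_sub, hJ, hA]
    ring
  have hBJ : B * J = J * B := by
    linear_combination (norm := (rw [hB]; noncomm_ring)) -(J * A) * hJJ + hJJ * (A * J)
  have hAB : LinearMap.trace K V (A * B) = 0 :=
    htr B hBskew fun u => by simpa using LinearMap.congr_fun hBJ u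
  have hJAJB : LinearMap.trace K V (J * A * J * B) = 0 := by
    rw [mul_assoc, ← hBJ, mul_assoc J, LinearMap.trace_mul_comm, mul_assoc, mul_assoc, hJJ]
    simp [hAB]
  have hB0 : B = 0 := eq_zero_of_skew_of_trace_mul_self_eq_zero hg hpos hBskew <| by
    rw [show B * B = A * B - J * A * J * B by rw [← sub_mul], map_sub, hAB, hJAJB, sub_zero]
  have hAJ := LinearMap.congr_fun (sub_eq_zero.1 (hB.symm.trans hB0)) (J u)
  simpa only [Module.End.mul_apply, hsq, map_neg] using hAJ

end Trace

section AlgebraicCurvature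

variable {k V ι : Type*} [CommRing k] [AddCommGroup V] [Module k V]

/-- `R` is an algebraic curvature tensor for the bilinear form `g`: it has the symmetries that the
curvature tensor `(u, v, w) ↦ R_{u,v} w` of a Levi-Civita connection has at a point. -/
structure IsAlgebraicCurvature (g : V →ₗ[k] V →ₗ[k] k) (R : V →ₗ[k] V →ₗ[k] V →ₗ[k] V) : Prop where
  swap : ∀ u v w, R v u w = -R u v w
  skew : ∀ u v w z, g (R u v w) z = -g w (R u v z)
  bianchi : ∀ u v w, R u v w + R v w u + R w u v = 0

variable [Fintype ι] [DecidableEq ι] {g : V →ₗ[k] V →ₗ[k] k} {e : Module.Basis ι k V}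
  {R C : V →ₗ[k] V →ₗ[k] V →ₗ[k] V} {ξ : V →ₗ[k] V →ₗ[k] V} {J : V →ₗ[k] V}

lemma IsAlgebraicCurvature.two_mul_sum_star (hR : IsAlgebraicCurvature g R)
    (hg : ∀ u v, g u v = g v u) (hJ : ∀ u v, g (J u) v = -g u (J v))
    (he : ∀ i j, g (e i) (e j) = if i = j then 1 else 0) (u v : V) :
    2 * ∑ i, g (R u (e i) (J v)) (J (e i)) = ∑ i, g (R (e i) (J (e i)) u) (J v) := by
  have hstar (i) : g (R u (e i) (J v)) (J (e i)) = -g (R u (e i) (J (e i))) (J v) := by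
    rw [hR.skew, hg (J v)]
  have hbianchi (i) : g (R (e i) (J (e i)) u) (J v)
      = g (R u (J (e i)) (e i)) (J v) - g (R u (e i) (J (e i))) (J v) := by
    have h := congr(g $(hR.bianchi (e i) (J (e i)) u) (J v))
    simp only [hR.swap u (J (e i)), map_add, map_neg, LinearMap.add_apply, LinearMap.neg_apply,
      map_zero, LinearMap.zero_apply] at h
    linear_combination h
  have hswap := sum_apply_skew_left he hg hJ ((R u).compr₂ (g.flip (J v)))
  simp only [LinearMap.compr₂_apply, LinearMap.flip_apply] at hswap
  simp only [hstar, hbianchi, Finset.sum_sub_distrib, Finset.sum_neg_distrib, hswap]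
  ring

lemma IsAlgebraicCurvature.two_mul_sum_star_sub (hR : IsAlgebraicCurvature g R)
    (hg : ∀ u v, g u v = g v u) (hsq : ∀ u, J (J u) = -u) (hJ : ∀ u v, g (J u) v = -g u (J v))
    (he : ∀ i j, g (e i) (e j) = if i = j then 1 else 0) (u v : V) :
    2 * (∑ i, g (R u (e i) (J v)) (J (e i)) - ∑ i, g (R (J u) (e i) (J (J v))) (J (e i)))
      = ∑ i, g (R (e i) (J (e i)) (J u) - J (R (e i) (J (e i)) u)) v := by
  rw [mul_sub, hR.two_mul_sum_star hg hJ he, hR.two_mul_sum_star hg hJ he]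
  simp only [hsq, map_sub, map_neg, LinearMap.sub_apply, hJ, Finset.sum_sub_distrib,
    Finset.sum_neg_distrib]
  ring

lemma sum_commutator_eq_sum_torsion (hg : ∀ u v, g u v = g v u)
    (hJ : ∀ u v, g (J u) v = -g u (J v)) (he : ∀ i j, g (e i) (e j) = if i = j then 1 else 0)
    (hξ : ∀ a w, ξ a (J w) = -J (ξ a w))
    (hRJ : ∀ a b w, R a b (J w) - J (R a b w)
      = (2 : k) • (C a b (J w) - C b a (J w) + ξ (ξ a b) (J w) - ξ (ξ b a) (J w))) (u v : V) :
    ∑ i, g (R (e i) (J (e i)) (J u) - J (R (e i) (J (e i)) u)) v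
      = 4 * (∑ i, g (C (e i) (J (e i)) (J u)) v - ∑ i, g (ξ (J (ξ (e i) (e i))) (J u)) v) := by
  have hC := congr(g $(sum_apply_skew_left he hg hJ (C.compr₂ (LinearMap.applyₗ (J u)))) v)
  have hξξ := congr(g $(sum_apply_skew_left he hg hJ (ξ.compr₂ (ξ.flip (J u)))) v)
  simp only [LinearMap.compr₂_apply, LinearMap.applyₗ_apply_apply, LinearMap.flip_apply,
    hξ (e _) (e _), map_sum, map_neg, LinearMap.sum_apply, LinearMap.neg_apply,
    Finset.sum_neg_distrib, neg_neg] at hC hξξ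
  simp only [hRJ, map_smul, map_add, map_sub, LinearMap.smul_apply, LinearMap.add_apply,
    LinearMap.sub_apply, smul_eq_mul, ← Finset.mul_sum, Finset.sum_add_distrib,
    Finset.sum_sub_distrib, hC, hξξ, hξ (e _) (e _), map_neg, LinearMap.neg_apply,
    Finset.sum_neg_distrib]
  ring

/-- The sum `ξ_a ξ_b + ξ_b ξ_a` is symmetric in `a` and `b`, so its trace against `J` vanishes. -/
lemma sum_torsion_eq_neg_sum_complex (hg : ∀ u v, g u v = g v u)
    (hJ : ∀ u v, g (J u) v = -g u (J v)) (he : ∀ i j, g (e i) (e j) = if i = j then 1 else 0)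
    (hξ : ∀ a w, ξ a (J w) = -J (ξ a w)) (hC : ∀ a b w, C a b (J w) = -J (C a b w)) (u v : V) :
    ∑ i, g (C (e i) (J (e i)) (J u)) v - ∑ i, g (ξ (J (ξ (e i) (e i))) (J u)) v
      = -∑ i, g (J (C (e i) (J (e i)) u + ξ (ξ (e i) (J (e i))) u
          + (ξ (e i) (ξ (J (e i)) u) + ξ (J (e i)) (ξ (e i) u)))) v := by
  have hsymm := congr(g (J $(sum_apply_skew_left he hg hJ
    (LinearMap.mk₂ k (fun a b => ξ a (ξ b u)) (by simp) (by simp) (by simp) (by simp)))) v)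
  simp only [LinearMap.mk₂_apply, map_sum, map_neg, LinearMap.sum_apply,
    LinearMap.neg_apply] at hsymm
  simp only [hC, hξ, map_add, map_neg, LinearMap.add_apply, LinearMap.neg_apply,
    Finset.sum_add_distrib, Finset.sum_neg_distrib] at hsymm ⊢
  rw [hsymm]
  ring

end AlgebraicCurvature

section LieConnection

variable {k L F : Type*} [CommRing k] [LieRing L] [LieAlgebra k L] [AddCommGroup F] [Module k F]
  {N S : L →ₗ[k] L →ₗ[k] L} {J : L →ₗ[k] L} {h : L →ₗ[k] L →ₗ[k] F}

/-- The curvature `R_{U,V} W = ∇_{[U,V]} W - (∇_U ∇_V W - ∇_V ∇_U W)` of a connection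
`N U W = ∇_U W` on a Lie algebra `L` of vector fields. -/
def curvatureMap (N : L →ₗ[k] L →ₗ[k] L) : L →ₗ[k] L →ₗ[k] L →ₗ[k] L :=
  LinearMap.mk₂ k (fun U V => N ⁅U, V⁆ - (N U ∘ₗ N V - N V ∘ₗ N U))
    (fun U V W => by
      ext Z
      simp only [add_lie, map_add, LinearMap.add_apply, LinearMap.sub_apply, LinearMap.comp_apply]
      abel)
    (fun c U V => by ext Z; simp [smul_sub])
    (fun U V W => by
      ext Z
      simp only [lie_add, map_add, LinearMap.add_apply, LinearMap.sub_apply, LinearMap.comp_apply]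
      abel)
    (fun c U V => by ext Z; simp [smul_sub])

@[simp] lemma curvatureMap_apply (N : L →ₗ[k] L →ₗ[k] L) (U V W : L) :
    curvatureMap N U V W = N ⁅U, V⁆ W - (N U (N V W) - N V (N U W)) := rfl

/-- The covariant derivative `(∇_U S)_V W = ∇_U (S_V W) - S_{∇_U V} W - S_V (∇_U W)` of a tensor `S`
of type (1,2) for a connection `N U W = ∇_U W`. -/
def covDerivMap (N S : L →ₗ[k] L →ₗ[k] L) : L →ₗ[k] L →ₗ[k] L →ₗ[k] L :=
  LinearMap.mk₂ k (fun U V => N U ∘ₗ S V - S (N U V) - S V ∘ₗ N U)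
    (fun U V W => by
      ext Z
      simp only [map_add, LinearMap.add_apply, LinearMap.sub_apply, LinearMap.comp_apply]
      abel)
    (fun c U V => by ext Z; simp [smul_sub])
    (fun U V W => by
      ext Z
      simp only [map_add, LinearMap.add_apply, LinearMap.sub_apply, LinearMap.comp_apply]
      abel)
    (fun c U V => by ext Z; simp [smul_sub])

@[simp] lemma covDerivMap_apply (N S : L →ₗ[k] L →ₗ[k] L) (U V W : L) :
    covDerivMap N S U V W = N U (S V W) - S (N U V) W - S V (N U W) := rfl

lemma curvatureMap_swap (N : L →ₗ[k] L →ₗ[k] L) (U V W : L) :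
    curvatureMap N V U W = -curvatureMap N U V W := by
  rw [curvatureMap_apply, curvatureMap_apply, ← lie_skew, map_neg, LinearMap.neg_apply]
  abel

lemma curvatureMap_bianchi (hN : ∀ U V, N U V - N V U = ⁅U, V⁆) (U V W : L) :
    curvatureMap N U V W + curvatureMap N V W U + curvatureMap N W U V = 0 := by
  have jacobi := lie_jacobi U V W
  simp only [← hN, map_sub, LinearMap.sub_apply] at jacobi
  simp only [curvatureMap_apply, ← hN, map_sub, LinearMap.sub_apply]
  linear_combination (norm := abel) -jacobi

lemma curvatureMap_skew [LieRingModule L F]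
    (hN : ∀ U V W, ⁅U, h V W⁆ = h (N U V) W + h V (N U W)) (U V W Z : L) :
    h (curvatureMap N U V W) Z = -h W (curvatureMap N U V Z) := by
  have hlie := lie_lie U V (h W Z)
  simp only [hN, lie_add] at hlie
  simp only [curvatureMap_apply, map_sub, LinearMap.sub_apply]
  linear_combination (norm := abel) hlie

lemma covDerivMap_skew [LieRingModule L F]
    (hN : ∀ U V W, ⁅U, h V W⁆ = h (N U V) W + h V (N U W))
    (hS : ∀ V W Z, h (S V W) Z = -h W (S V Z)) (U V W Z : L) :
    h (covDerivMap N S U V W) Z = -h W (covDerivMap N S U V Z) := by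
  have hlie : ⁅U, h (S V W) Z⁆ = -⁅U, h W (S V Z)⁆ := by rw [hS, lie_neg]
  simp only [hN] at hlie
  simp only [covDerivMap_apply, map_sub, LinearMap.sub_apply, hS] at hlie ⊢
  linear_combination (norm := abel) hlie

lemma covDerivMap_anticomm (hNJ : ∀ U W, N U (J W) = J (N U W))
    (hSJ : ∀ U W, S U (J W) = -J (S U W)) (U V W : L) :
    covDerivMap N S U V (J W) = -J (covDerivMap N S U V W) := by
  simp only [covDerivMap_apply, hNJ, hSJ, map_sub, map_neg]
  abel

lemma covDerivMap_comp (hNJ : ∀ U W, (N + S) U (J W) = J ((N + S) U W))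
    (hSJ : ∀ U W, S U (J W) = -J (S U W)) (U V W : L) :
    covDerivMap N (S.compr₂ J) U V W = J (covDerivMap (N + S) S U V W + S (S U V) W
      + (S U (S V W) + S V (S U W))) := by
  have hN (U W) : N U (J W) = J (N U W) + J (S U W) + J (S U W) := by
    have h := hNJ U W
    simp only [LinearMap.add_apply, map_add, hSJ] at h
    linear_combination (norm := abel) h
  simp only [covDerivMap_apply, LinearMap.compr₂_apply, hN, LinearMap.add_apply, map_add, map_sub]
  abel

/-- In terms of `∇̃ = N + S`, whose curvature commutes with `J`, the curvature of `N` is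
`R_{U,V} = R̃_{U,V} + (∇̃_U S)_V - (∇̃_V S)_U - [S_U, S_V] + S_{S_U V} - S_{S_V U}`, and
`[S_U, S_V]` commutes with `J` too. -/
lemma curvatureMap_commutator (hN : ∀ U V, N U V - N V U = ⁅U, V⁆)
    (hNJ : ∀ U W, (N + S) U (J W) = J ((N + S) U W)) (hSJ : ∀ U W, S U (J W) = -J (S U W))
    (U V W : L) :
    curvatureMap N U V (J W) - J (curvatureMap N U V W)
      = (2 : k) • (covDerivMap (N + S) S U V (J W) - covDerivMap (N + S) S V U (J W)
        + S (S U V) (J W) - S (S V U) (J W)) := by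
  have hcurv (W) : curvatureMap N U V W = curvatureMap (N + S) U V W
      + (covDerivMap (N + S) S U V W - covDerivMap (N + S) S V U W + S (S U V) W - S (S V U) W)
      - (S U (S V W) - S V (S U W)) := by
    simp only [curvatureMap_apply, covDerivMap_apply, ← hN, map_add, map_sub, LinearMap.add_apply,
      LinearMap.sub_apply]
    abel
  have hcomm : curvatureMap (N + S) U V (J W) = J (curvatureMap (N + S) U V W) := by
    simp only [curvatureMap_apply, hNJ, map_sub]
  simp only [hcurv, hcomm, covDerivMap_anticomm hNJ hSJ, hSJ, map_add, map_sub, map_neg]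
  module

end LieConnection

noncomputable section VectorFields

variable {E : Type*} [NormedAddCommGroup E] [NormedSpace ℝ E]
  {M : Type*} [TopologicalSpace M] [ChartedSpace E M] [IsManifold 𝓘(ℝ, E) ∞ M]

variable (E M) in
/-- The smooth vector fields on `M`. -/
abbrev SmoothField : Type _ :=
  ContMDiffSection 𝓘(ℝ, E) E ∞ (TangentSpace 𝓘(ℝ, E) : M → Type _)

variable (E M) in
/-- The algebra of smooth real functions on `M`. -/
abbrev SmoothFunction : Type _ := C^∞⟮𝓘(ℝ, E), M; ℝ⟯

/-- The value of a vector field at a point. -/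
def SmoothField.eval (x : M) : SmoothField E M →ₗ[ℝ] TangentSpace 𝓘(ℝ, E) x where
  toFun U := U x
  map_add' _ _ := rfl
  map_smul' _ _ := rfl

@[simp] lemma SmoothField.eval_apply (x : M) (U : SmoothField E M) :
    SmoothField.eval x U = U x := rfl

/-- The pointwise product of a smooth function and a smooth vector field. -/
instance : SMul (SmoothFunction E M) (SmoothField E M) where
  smul f W := ⟨⇑f • ⇑W, f.contMDiff.smul_section W.contMDiff⟩

@[simp] lemma smul_field_apply (f : SmoothFunction E M) (W : SmoothField E M) (y : M) :
    (f • W) y = f y • W y := rfl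

/-- The derivative of a smooth function along a smooth vector field. -/
instance : Bracket (SmoothField E M) (SmoothFunction E M) where
  bracket V f := ⟨fun y => d% f y (V y), by
    have h := (f.contMDiff.contMDiff_tangentMap (m := ∞) (by simp)).comp V.contMDiff
    exact (contMDiff_snd_tangentBundle_modelSpace ℝ 𝓘(ℝ, ℝ)).comp h⟩

lemma lie_function_apply (V : SmoothField E M) (f : SmoothFunction E M) (y : M) :
    ⁅V, f⁆ y = d% f y (V y) := rfl

/-- The vector field that is constant in the preferred trivialization at `x`, and zero outside its
domain. It depends linearly on its value at `x`. -/
def localConstField (x : M) (y : M) : TangentSpace 𝓘(ℝ, E) x →ₗ[ℝ] TangentSpace 𝓘(ℝ, E) y :=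
  (trivializationAt E (TangentSpace 𝓘(ℝ, E) : M → Type _) x).symmₗ ℝ y ∘ₗ
    (trivializationAt E (TangentSpace 𝓘(ℝ, E) : M → Type _) x).linearMapAt ℝ x

lemma localConstField_eq_extend {x y : M} (u : TangentSpace 𝓘(ℝ, E) x)
    (hy : y ∈ (trivializationAt E (TangentSpace 𝓘(ℝ, E) : M → Type _) x).baseSet) :
    localConstField x y u = FiberBundle.extend E u y := by
  have hx := FiberBundle.mem_baseSet_trivializationAt' (F := E)
    (E := (TangentSpace 𝓘(ℝ, E) : M → Type _)) x
  rw [localConstField, LinearMap.comp_apply, Trivialization.linearMapAt_apply, if_pos hx,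
    Trivialization.symmₗ_apply _ hy]
  rfl

lemma contMDiffOn_localConstField {x : M} (u : TangentSpace 𝓘(ℝ, E) x) :
    CMDiff[(trivializationAt E (TangentSpace 𝓘(ℝ, E) : M → Type _) x).baseSet] ∞
      (T% (fun y => localConstField x y u)) := by
  intro y hy
  rw [(trivializationAt E (TangentSpace 𝓘(ℝ, E) : M → Type _) x).contMDiffWithinAt_section _ hy]
  refine (contMDiffOn_const (c :=
    (trivializationAt E (TangentSpace 𝓘(ℝ, E) : M → Type _) x ⟨x, u⟩).2)).congr
    (fun z hz => ?_) y hy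
  rw [localConstField_eq_extend u hz, FiberBundle.extend, Trivialization.apply_mk_symm _ hz]

variable [FiniteDimensional ℝ E]

lemma minSmoothness_le_infty (k : ℕ) : minSmoothness ℝ k ≤ ∞ := by
  rw [minSmoothness_of_isRCLikeNormedField]
  exact mod_cast le_top

/-- The Lie bracket of smooth vector fields. -/
instance : Bracket (SmoothField E M) (SmoothField E M) where
  bracket U W := ⟨VectorField.mlieBracket 𝓘(ℝ, E) U W, by
    have := FiniteDimensional.complete ℝ E
    have : IsManifold 𝓘(ℝ, E) (minSmoothness ℝ 2) M := .of_le (minSmoothness_le_infty 2)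
    have : IsManifold 𝓘(ℝ, E) (∞ + 1) M := .of_le (n := ∞) le_rfl
    exact ContDiff.mlieBracket_vectorField (m := ⊤) (n := ⊤) U.contMDiff W.contMDiff (by simp)⟩

instance : LieRing (SmoothField E M) where
  add_lie U V W := by
    ext y; exact VectorField.mlieBracket_add_left U.mdifferentiableAt V.mdifferentiableAt
  lie_add U V W := by
    ext y; exact VectorField.mlieBracket_add_right V.mdifferentiableAt W.mdifferentiableAt
  lie_self U := by ext y; exact congrFun VectorField.mlieBracket_self y
  leibniz_lie U V W := by
    have := FiniteDimensional.complete ℝ E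
    have : IsManifold 𝓘(ℝ, E) (minSmoothness ℝ 3) M := .of_le (minSmoothness_le_infty 3)
    have smooth (X : SmoothField E M) (y : M) := X.contMDiff.contMDiffAt.of_le (x := y)
      (minSmoothness_le_infty 2)
    ext y
    exact VectorField.leibniz_identity_mlieBracket_apply (smooth U y) (smooth V y) (smooth W y)

instance : LieAlgebra ℝ (SmoothField E M) where
  lie_smul c U W := by
    ext y; exact VectorField.mlieBracket_const_smul_right W.mdifferentiableAt

lemma lie_smul_field (V W : SmoothField E M) (f : SmoothFunction E M) :
    ⁅V, f • W⁆ = ⁅V, f⁆ • W + f • ⁅V, W⁆ := by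
  have := FiniteDimensional.complete ℝ E
  ext y
  exact VectorField.mlieBracket_smul_right (f.contMDiff.mdifferentiableAt (by simp))
    W.mdifferentiableAt

variable (E) in
/-- A smooth bump function centered at `x`, used to extend vector fields from a neighborhood
of `x`. -/
def bumpAt (x : M) : SmoothBumpFunction 𝓘(ℝ, E) x := Classical.arbitrary _

variable [T2Space M]

variable (E) in
/-- A smooth vector field with prescribed value at `x`, depending linearly on the value: near `x` it
is constant in the preferred trivialization. -/
def extendField (x : M) : TangentSpace 𝓘(ℝ, E) x →ₗ[ℝ] SmoothField E M where
  toFun u := ⟨⇑(bumpAt E x) • fun y => localConstField x y u,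
    ContMDiffOn.smul_section_of_tsupport (bumpAt E x).contMDiff.contMDiffOn
      (trivializationAt E (TangentSpace 𝓘(ℝ, E) : M → Type _) x).open_baseSet
      (bumpAt E x).tsupport_subset_chartAt_source (contMDiffOn_localConstField u)⟩
  map_add' u v := by ext y; simp
  map_smul' c u := by ext y; simp [smul_comm c]

lemma extend_eventuallyEq_extendField {x : M} (u : TangentSpace 𝓘(ℝ, E) x) :
    ∀ᶠ y in nhds x, FiberBundle.extend E u y = extendField E x u y := by
  filter_upwards [(bumpAt E x).eventuallyEq_one,
    (trivializationAt E (TangentSpace 𝓘(ℝ, E) : M → Type _) x).open_baseSet.mem_nhds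
      (FiberBundle.mem_baseSet_trivializationAt' x)] with y hy hy'
  change _ = bumpAt E x y • localConstField x y u
  rw [hy, localConstField_eq_extend u hy', Pi.one_apply, one_smul]

@[simp] lemma extendField_self {x : M} (u : TangentSpace 𝓘(ℝ, E) x) :
    extendField E x u x = u := by
  rw [← (extend_eventuallyEq_extendField u).self_of_nhds, FiberBundle.extend_apply_self]

/-- The Jacobi identity for `U`, `V` and `f • W`, where `W` does not vanish at the given point. -/
lemma leibniz_lie_function (U V : SmoothField E M) (f : SmoothFunction E M) :
    ⁅U, ⁅V, f⁆⁆ = ⁅⁅U, V⁆, f⁆ + ⁅V, ⁅U, f⁆⁆ := by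
  ext x
  rcases subsingleton_or_nontrivial (TangentSpace 𝓘(ℝ, E) x) with _ | _
  · have (X : SmoothField E M) (φ : SmoothFunction E M) : ⁅X, φ⁆ x = 0 := by
      rw [lie_function_apply, Subsingleton.elim (X x) 0, map_zero]
    simp [this]
  · obtain ⟨w, hw⟩ := exists_ne (0 : TangentSpace 𝓘(ℝ, E) x)
    have jacobi := leibniz_lie U V (f • extendField E x w)
    simp only [lie_smul_field, lie_add, leibniz_lie U V (extendField E x w)] at jacobi
    have hx := congr(SmoothField.eval x $jacobi)
    simp only [map_add, SmoothField.eval_apply, smul_field_apply, ContMDiffSection.coe_add,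
      Pi.add_apply, extendField_self, smul_add] at hx
    refine smul_left_injective ℝ hw ?_
    simp only [ContMDiffMap.coe_add, Pi.add_apply]
    linear_combination (norm := module) hx

instance : LieRingModule (SmoothField E M) (SmoothFunction E M) where
  add_lie U V f := by ext y; exact map_add (d% f y) _ _
  lie_add U f₁ f₂ := by
    ext y
    exact congr($(mvfderiv_add (f₁.contMDiff.mdifferentiableAt (by simp))
      (f₂.contMDiff.mdifferentiableAt (by simp))) (U y))
  leibniz_lie := leibniz_lie_function

end VectorFields

noncomputable section Connections

variable {E : Type*} [NormedAddCommGroup E] [NormedSpace ℝ E]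
  {M : Type*} [TopologicalSpace M] [ChartedSpace E M] [IsManifold 𝓘(ℝ, E) ∞ M]

/-- The metric at a point as a bilinear form. -/
def metricForm (g : ContMDiffRiemannianMetric 𝓘(ℝ, E) ∞ E (fun x : M => TangentSpace 𝓘(ℝ, E) x))
    (x : M) : TangentSpace 𝓘(ℝ, E) x →ₗ[ℝ] TangentSpace 𝓘(ℝ, E) x →ₗ[ℝ] ℝ :=
  (ContinuousLinearMap.coeLM ℝ).comp (g.inner x).toLinearMap

/-- The metric as a bilinear map from smooth vector fields to smooth functions. -/
def metricMap (g : ContMDiffRiemannianMetric 𝓘(ℝ, E) ∞ E (fun x : M => TangentSpace 𝓘(ℝ, E) x)) :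
    SmoothField E M →ₗ[ℝ] SmoothField E M →ₗ[ℝ] SmoothFunction E M :=
  LinearMap.mk₂ ℝ (fun W Z => ⟨fun y => g.inner y (W y) (Z y), by
      have h : ContMDiff 𝓘(ℝ, E) (𝓘(ℝ, E).prod 𝓘(ℝ, ℝ)) ∞
          (fun y => TotalSpace.mk' ℝ (E := Bundle.Trivial M ℝ) y (g.inner y (W y) (Z y))) :=
        g.contMDiff.clm_bundle_apply₂ W.contMDiff Z.contMDiff
      exact fun y => (contMDiffAt_section _).1 (h y)⟩)
    (fun U V W => by ext y; exact (metricForm g y).map_add₂ _ _ _)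
    (fun c U W => by ext y; exact (metricForm g y).map_smul₂ _ _ _)
    (fun U V W => by ext y; exact (metricForm g y (U y)).map_add _ _)
    (fun c U W => by ext y; exact (metricForm g y (U y)).map_smul _ _)

/-- The action of a smooth connection on smooth vector fields, `(U, W) ↦ ∇_U W`. -/
def connectionMap (D : CovariantDerivative 𝓘(ℝ, E) E (TangentSpace 𝓘(ℝ, E) : M → Type _))
    (hD : D.ContMDiffCovariantDerivative ∞) :
    SmoothField E M →ₗ[ℝ] SmoothField E M →ₗ[ℝ] SmoothField E M :=
  LinearMap.mk₂ ℝ (fun U W => ⟨fun y => D W y (U y), by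
      have h := hD.contMDiff.contMDiff (σ := W) W.contMDiff.contMDiffOn
      exact (contMDiffOn_univ.1 h).clm_bundle_apply U.contMDiff⟩)
    (fun U V W => by ext y; exact (D W y).map_add _ _)
    (fun c U W => by ext y; exact (D W y).map_smul _ _)
    (fun U V W => by
      ext y
      exact congr($(D.isCovariantDerivativeOn.add (s := Set.univ) V.mdifferentiableAt
        W.mdifferentiableAt) (U y)))
    (fun c U W => by
      ext y
      exact congr($(D.isCovariantDerivativeOn.smul_const (s := Set.univ) c
        W.mdifferentiableAt) (U y)))

variable {g : ContMDiffRiemannianMetric 𝓘(ℝ, E) ∞ E (fun x : M => TangentSpace 𝓘(ℝ, E) x)}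
  {D : CovariantDerivative 𝓘(ℝ, E) E (TangentSpace 𝓘(ℝ, E) : M → Type _)}

lemma metricMap_apply (W Z : SmoothField E M) (y : M) :
    metricMap g W Z y = g.inner y (W y) (Z y) := rfl

@[simp] lemma connectionMap_apply (hD : D.ContMDiffCovariantDerivative ∞) (U W : SmoothField E M)
    (y : M) : connectionMap D hD U W y = D W y (U y) := rfl

lemma IsMetric.lie_metricMap (hg : IsMetric g D) (hD : D.ContMDiffCovariantDerivative ∞)
    (U V W : SmoothField E M) :
    ⁅U, metricMap g V W⁆
      = metricMap g (connectionMap D hD U V) W + metricMap g V (connectionMap D hD U W) := by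
  ext y
  exact hg y V W (U y) V.mdifferentiableAt W.mdifferentiableAt

lemma covariantDerivative_congr {x : M} {σ : ∀ y : M, TangentSpace 𝓘(ℝ, E) y}
    {W : SmoothField E M} (h : ∀ᶠ y in nhds x, σ y = W y) : D σ x = D W x :=
  D.isCovariantDerivativeOn.congr_of_eventuallyEq (s := Set.univ)
    (W.mdifferentiableAt.congr_of_eventuallyEq (h.mono fun y hy => by simp only [hy]))
    W.mdifferentiableAt Filter.univ_mem h

variable [FiniteDimensional ℝ E]

lemma IsLeviCivita.connectionMap_sub_swap (hD : IsLeviCivita g D) (U V : SmoothField E M) :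
    connectionMap D hD.smooth U V - connectionMap D hD.smooth V U = ⁅U, V⁆ := by
  have := FiniteDimensional.complete ℝ E
  ext y
  exact D.torsion_eq_zero_iff.1 hD.torsion_free U.mdifferentiableAt V.mdifferentiableAt

variable [T2Space M]

/-- The trilinear operation on `T_x M` obtained by applying `P` to the fields `extendField`. It is
the value of `P` at `x` when `P` is tensorial. -/
def restrictAt (x : M)
    (P : SmoothField E M →ₗ[ℝ] SmoothField E M →ₗ[ℝ] SmoothField E M →ₗ[ℝ] SmoothField E M) :
    TangentSpace 𝓘(ℝ, E) x →ₗ[ℝ] TangentSpace 𝓘(ℝ, E) x →ₗ[ℝ] TangentSpace 𝓘(ℝ, E) x →ₗ[ℝ]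
      TangentSpace 𝓘(ℝ, E) x :=
  LinearMap.mk₂ ℝ
    (fun u v => SmoothField.eval x ∘ₗ P (extendField E x u) (extendField E x v) ∘ₗ extendField E x)
    (fun u v w => by ext z; simp) (fun c u v => by ext z; simp)
    (fun u v w => by ext z; simp) (fun c u v => by ext z; simp)

lemma restrictAt_apply (x : M)
    (P : SmoothField E M →ₗ[ℝ] SmoothField E M →ₗ[ℝ] SmoothField E M →ₗ[ℝ] SmoothField E M)
    (u v w : TangentSpace 𝓘(ℝ, E) x) : restrictAt x P u v w
      = P (extendField E x u) (extendField E x v) (extendField E x w) x := rfl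

/-- A skew operator is tensorial: `⟨P_{U,V} W, z⟩ = -⟨W, P_{U,V} Z⟩` depends on `W` only through its
value at the given point. -/
lemma restrictAt_apply_of_skew {x : M}
    {P : SmoothField E M →ₗ[ℝ] SmoothField E M →ₗ[ℝ] SmoothField E M →ₗ[ℝ] SmoothField E M}
    (hP : ∀ U V W Z, metricMap g (P U V W) Z = -metricMap g W (P U V Z))
    (u v : TangentSpace 𝓘(ℝ, E) x) (W : SmoothField E M) :
    restrictAt x P u v (W x) = P (extendField E x u) (extendField E x v) W x := by
  have hskew (W Z) : g.inner x (P (extendField E x u) (extendField E x v) W x) (Z x)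
      = -g.inner x (W x) (P (extendField E x u) (extendField E x v) Z x) := congr($(hP _ _ W Z) x)
  have hinner (z) : g.inner x (restrictAt x P u v (W x)) z
      = g.inner x (P (extendField E x u) (extendField E x v) W x) z := by
    rw [← extendField_self (E := E) z, restrictAt_apply, hskew, hskew, extendField_self]
  by_contra hne
  refine (g.pos x _ (sub_ne_zero.2 hne)).ne' ?_
  rw [(g.inner x).map_sub, sub_apply, hinner, sub_self]

lemma curvature_eq_restrictAt (hD : D.ContMDiffCovariantDerivative ∞) (x : M)
    (u v w : TangentSpace 𝓘(ℝ, E) x) :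
    curvature D x u v w = restrictAt x (curvatureMap (connectionMap D hD)) u v w := by
  have hDext (u v : TangentSpace 𝓘(ℝ, E) x) :
      ∀ᶠ y in nhds x, D (FiberBundle.extend E v) y (FiberBundle.extend E u y)
        = connectionMap D hD (extendField E x u) (extendField E x v) y := by
    filter_upwards [(extend_eventuallyEq_extendField v).eventually_nhds,
      extend_eventuallyEq_extendField u] with y hv hu
    rw [covariantDerivative_congr hv, hu, connectionMap_apply]
  rw [curvature, curvatureField, covariantDerivative_congr (hDext v w),
    covariantDerivative_congr (hDext u w),
    covariantDerivative_congr (extend_eventuallyEq_extendField w),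
    Filter.EventuallyEq.mlieBracket_vectorField_eq (extend_eventuallyEq_extendField u)
      (extend_eventuallyEq_extendField v), (extend_eventuallyEq_extendField u).self_of_nhds,
    (extend_eventuallyEq_extendField v).self_of_nhds]
  rfl

lemma covDerivTensor_eq_restrictAt (hD : D.ContMDiffCovariantDerivative ∞)
    {T : ∀ x : M, TangentSpace 𝓘(ℝ, E) x →ₗ[ℝ] TangentSpace 𝓘(ℝ, E) x →ₗ[ℝ]
      TangentSpace 𝓘(ℝ, E) x}
    {S : SmoothField E M →ₗ[ℝ] SmoothField E M →ₗ[ℝ] SmoothField E M}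
    (hS : ∀ U V y, S U V y = T y (U y) (V y)) (x : M) (u v w : TangentSpace 𝓘(ℝ, E) x) :
    covDerivTensor D T x u v w = restrictAt x (covDerivMap (connectionMap D hD) S) u v w := by
  have hText : ∀ᶠ y in nhds x, T y (FiberBundle.extend E v y) (FiberBundle.extend E w y)
      = S (extendField E x v) (extendField E x w) y := by
    filter_upwards [extend_eventuallyEq_extendField v,
      extend_eventuallyEq_extendField w] with y hv hw
    rw [hS, hv, hw]
  rw [covDerivTensor, covariantDerivative_congr hText,
    covariantDerivative_congr (extend_eventuallyEq_extendField v),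
    covariantDerivative_congr (extend_eventuallyEq_extendField w)]
  simp [restrictAt_apply, hS]

lemma IsLeviCivita.isAlgebraicCurvature (hD : IsLeviCivita g D) (x : M) :
    IsAlgebraicCurvature (metricForm g x)
      (restrictAt x (curvatureMap (connectionMap D hD.smooth))) where
  swap u v w := congr(SmoothField.eval x $(curvatureMap_swap _ _ _ _))
  skew u v w z := by
    have h := congr($(curvatureMap_skew (hD.metric.lie_metricMap hD.smooth) (extendField E x u)
      (extendField E x v) (extendField E x w) (extendField E x z)) x)
    rwa [metricMap_apply, extendField_self, ContMDiffMap.coe_neg, Pi.neg_apply, metricMap_apply,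
      extendField_self] at h
  bianchi u v w := congr(SmoothField.eval x $(curvatureMap_bianchi hD.connectionMap_sub_swap _ _ _))

end Connections

noncomputable section IntrinsicTorsion

variable {E : Type*} [NormedAddCommGroup E] [NormedSpace ℝ E]
  {M : Type*} [TopologicalSpace M] [ChartedSpace E M] [IsManifold 𝓘(ℝ, E) ∞ M]
  {g : ContMDiffRiemannianMetric 𝓘(ℝ, E) ∞ E (fun x : M => TangentSpace 𝓘(ℝ, E) x)}
  {J : ∀ x : M, TangentSpace 𝓘(ℝ, E) x →L[ℝ] TangentSpace 𝓘(ℝ, E) x}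
  {D Dt : CovariantDerivative 𝓘(ℝ, E) E (TangentSpace 𝓘(ℝ, E) : M → Type _)}

/-- The action of the almost complex structure on smooth vector fields. -/
def complexMap (hJ : IsAlmostHermitian g J) : SmoothField E M →ₗ[ℝ] SmoothField E M where
  toFun W := ⟨fun y => J y (W y), hJ.smooth.clm_bundle_apply W.contMDiff⟩
  map_add' U V := by ext y; exact (J y).map_add _ _
  map_smul' c U := by ext y; exact (J y).map_smul _ _

@[simp] lemma complexMap_apply (hJ : IsAlmostHermitian g J) (W : SmoothField E M) (y : M) :
    complexMap hJ W y = J y (W y) := rfl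

lemma IsAlmostHermitian.skew (hJ : IsAlmostHermitian g J) (x : M)
    (u v : TangentSpace 𝓘(ℝ, E) x) : g.inner x (J x u) v = -g.inner x u (J x v) := by
  rw [← hJ.orthogonal x u (J x v), hJ.sq, map_neg, neg_neg]

/-- The difference tensor `ξ = ∇̃ - ∇` of two smooth connections as an operation on smooth vector
fields, `(U, W) ↦ ξ_U W`. -/
def differenceMap (hD : D.ContMDiffCovariantDerivative ∞)
    (hDt : Dt.ContMDiffCovariantDerivative ∞) :
    SmoothField E M →ₗ[ℝ] SmoothField E M →ₗ[ℝ] SmoothField E M :=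
  connectionMap Dt hDt - connectionMap D hD

lemma connectionMap_add_differenceMap (hD : D.ContMDiffCovariantDerivative ∞)
    (hDt : Dt.ContMDiffCovariantDerivative ∞) :
    connectionMap D hD + differenceMap hD hDt = connectionMap Dt hDt :=
  add_sub_cancel _ _

variable [FiniteDimensional ℝ E]

lemma differenceMap_apply (hD : D.ContMDiffCovariantDerivative ∞)
    (hDt : Dt.ContMDiffCovariantDerivative ∞) (U W : SmoothField E M) (x : M) :
    differenceMap hD hDt U W x = differenceTensor D Dt x (U x) (W x) := by
  have h : Dt.difference D x (W x) = Dt W x - D W x :=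
    IsCovariantDerivativeOn.difference_apply _ _ (Set.mem_univ x) W.mdifferentiableAt
  exact congr($h.symm (U x))

namespace IsMinimalUnitary

lemma connectionMap_complexMap (hDt : IsMinimalUnitary g J D Dt) (hJ : IsAlmostHermitian g J)
    (U V : SmoothField E M) :
    connectionMap Dt hDt.smooth U (complexMap hJ V)
      = complexMap hJ (connectionMap Dt hDt.smooth U V) := by
  ext y
  exact hDt.parallel y V (U y) V.mdifferentiableAt

lemma differenceTensor_anticomm (hDt : IsMinimalUnitary g J D Dt) (hJ : IsAlmostHermitian g J)
    (x : M) (u v : TangentSpace 𝓘(ℝ, E) x) :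
    differenceTensor D Dt x u (J x v) = -J x (differenceTensor D Dt x u v) := by
  have : FiniteDimensional ℝ (TangentSpace 𝓘(ℝ, E) x) := inferInstanceAs (FiniteDimensional ℝ E)
  exact complex_anticomm_of_trace_eq_zero (g := metricForm g x) (J := (J x).toLinearMap)
    (g.symm x) (g.pos x) (hJ.sq x) (hJ.skew x) (hDt.perp x u).1 (hDt.perp x u).2 v

lemma differenceMap_anticomm (hDt : IsMinimalUnitary g J D Dt) (hJ : IsAlmostHermitian g J)
    (hD : D.ContMDiffCovariantDerivative ∞) (U W : SmoothField E M) :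
    differenceMap hD hDt.smooth U (complexMap hJ W)
      = -complexMap hJ (differenceMap hD hDt.smooth U W) := by
  ext y
  simpa [differenceMap_apply] using hDt.differenceTensor_anticomm hJ y (U y) (W y)

lemma differenceMap_skew (hDt : IsMinimalUnitary g J D Dt)
    (hD : D.ContMDiffCovariantDerivative ∞) (U W Z : SmoothField E M) :
    metricMap g (differenceMap hD hDt.smooth U W) Z
      = -metricMap g W (differenceMap hD hDt.smooth U Z) := by
  ext y
  simpa [metricMap_apply, differenceMap_apply] using (hDt.perp y (U y)).1 (W y) (Z y)

variable [T2Space M]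

lemma covDerivTensor_anticomm (hDt : IsMinimalUnitary g J D Dt) (hJ : IsAlmostHermitian g J)
    (hD : D.ContMDiffCovariantDerivative ∞) (x : M) (u v w : TangentSpace 𝓘(ℝ, E) x) :
    covDerivTensor Dt (differenceTensor D Dt) x u v (J x w)
      = -J x (covDerivTensor Dt (differenceTensor D Dt) x u v w) := by
  have hJw : J x w = complexMap hJ (extendField E x w) x := by simp
  simp only [covDerivTensor_eq_restrictAt hDt.smooth (differenceMap_apply hD hDt.smooth)]
  rw [hJw, restrictAt_apply_of_skew (covDerivMap_skew (hDt.metric.lie_metricMap hDt.smooth)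
      (hDt.differenceMap_skew hD)), covDerivMap_anticomm (hDt.connectionMap_complexMap hJ)
      (hDt.differenceMap_anticomm hJ hD)]
  rfl

lemma covDerivTensor_compTensor (hDt : IsMinimalUnitary g J D Dt) (hJ : IsAlmostHermitian g J)
    (hD : D.ContMDiffCovariantDerivative ∞) (x : M) (u v w : TangentSpace 𝓘(ℝ, E) x) :
    covDerivTensor D (compTensor J (differenceTensor D Dt)) x u v w
      = J x (covDerivTensor Dt (differenceTensor D Dt) x u v w
        + differenceTensor D Dt x (differenceTensor D Dt x u v) w
        + (differenceTensor D Dt x u (differenceTensor D Dt x v w)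
          + differenceTensor D Dt x v (differenceTensor D Dt x u w))) := by
  have hNJ := hDt.connectionMap_complexMap hJ
  rw [← connectionMap_add_differenceMap hD] at hNJ
  rw [covDerivTensor_eq_restrictAt hDt.smooth (differenceMap_apply hD hDt.smooth),
    covDerivTensor_eq_restrictAt hD (T := compTensor J (differenceTensor D Dt))
      (S := (differenceMap hD hDt.smooth).compr₂ (complexMap hJ))
      (fun U V y => congrArg (J y) (differenceMap_apply hD hDt.smooth U V y)),
    restrictAt_apply, covDerivMap_comp hNJ (hDt.differenceMap_anticomm hJ hD),
    connectionMap_add_differenceMap]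
  simp only [complexMap_apply, ContMDiffSection.coe_add, Pi.add_apply, differenceMap_apply,
    extendField_self, restrictAt_apply]

lemma curvature_commutator (hDt : IsMinimalUnitary g J D Dt) (hJ : IsAlmostHermitian g J)
    (hD : IsLeviCivita g D) (x : M) (u v w : TangentSpace 𝓘(ℝ, E) x) :
    curvature D x u v (J x w) - J x (curvature D x u v w)
      = (2 : ℝ) • (covDerivTensor Dt (differenceTensor D Dt) x u v (J x w)
        - covDerivTensor Dt (differenceTensor D Dt) x v u (J x w)
        + differenceTensor D Dt x (differenceTensor D Dt x u v) (J x w)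
        - differenceTensor D Dt x (differenceTensor D Dt x v u) (J x w)) := by
  have hNJ := hDt.connectionMap_complexMap hJ
  rw [← connectionMap_add_differenceMap hD.smooth] at hNJ
  have hfield := congr(SmoothField.eval x $(curvatureMap_commutator hD.connectionMap_sub_swap hNJ
    (hDt.differenceMap_anticomm hJ hD.smooth) (extendField E x u) (extendField E x v)
    (extendField E x w)))
  have hJw : J x w = complexMap hJ (extendField E x w) x := by simp
  simp only [curvature_eq_restrictAt hD.smooth,
    covDerivTensor_eq_restrictAt hDt.smooth (differenceMap_apply hD.smooth hDt.smooth)]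
  have hR := curvatureMap_skew (hD.metric.lie_metricMap hD.smooth)
  have hC := covDerivMap_skew (hDt.metric.lie_metricMap hDt.smooth)
    (hDt.differenceMap_skew hD.smooth)
  rw [hJw, restrictAt_apply_of_skew hR, restrictAt_apply_of_skew hC, restrictAt_apply_of_skew hC]
  simpa only [connectionMap_add_differenceMap, map_sub, map_add, map_smul, SmoothField.eval_apply,
    differenceMap_apply, complexMap_apply, restrictAt_apply, extendField_self] using hfield

variable {x : M} {m : ℕ} {e : Module.Basis (Fin m) ℝ (TangentSpace 𝓘(ℝ, E) x)}

lemma antiHermitianPart_starRicci (hDt : IsMinimalUnitary g J D Dt) (hJ : IsAlmostHermitian g J)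
    (hD : IsLeviCivita g D) (he : IsOrthonormalBasis g e) (u v : TangentSpace 𝓘(ℝ, E) x) :
    antiHermitianPart J (starRicci g J D e) u v
      = ∑ i, g.inner x (covDerivTensor Dt (differenceTensor D Dt) x (e i) (J x (e i)) (J x u)) v
        - ∑ i, g.inner x (differenceTensor D Dt x (J x (differenceTensor D Dt x (e i) (e i)))
          (J x u)) v := by
  have hC := covDerivTensor_eq_restrictAt hDt.smooth (differenceMap_apply hD.smooth hDt.smooth) x
  have hR := curvature_eq_restrictAt hD.smooth x
  have hcomm := hDt.curvature_commutator hJ hD x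
  simp only [hC, hR] at hcomm
  have hstar := (hD.isAlgebraicCurvature x).two_mul_sum_star_sub (J := (J x).toLinearMap)
    (g.symm x) (hJ.sq x) (hJ.skew x) he u v
  have htorsion := sum_commutator_eq_sum_torsion (g := metricForm g x) (J := (J x).toLinearMap)
    (g.symm x) (hJ.skew x) he (hDt.differenceTensor_anticomm hJ x) hcomm u v
  have half {a b : ℝ} (h : 2 * a = 4 * b) : a / 2 = b := by linarith
  simp only [antiHermitianPart, starRicci, hC, hR]
  exact half (hstar.trans htorsion)

lemma sum_covDerivTensor_sub_eq_neg_sum (hDt : IsMinimalUnitary g J D Dt)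
    (hJ : IsAlmostHermitian g J) (hD : D.ContMDiffCovariantDerivative ∞)
    (he : IsOrthonormalBasis g e) (u v : TangentSpace 𝓘(ℝ, E) x) :
    ∑ i, g.inner x (covDerivTensor Dt (differenceTensor D Dt) x (e i) (J x (e i)) (J x u)) v
        - ∑ i, g.inner x (differenceTensor D Dt x (J x (differenceTensor D Dt x (e i) (e i)))
          (J x u)) v
      = -∑ i, g.inner x
        (covDerivTensor D (compTensor J (differenceTensor D Dt)) x (e i) (J x (e i)) u) v := by
  have hC := covDerivTensor_eq_restrictAt hDt.smooth (differenceMap_apply hD hDt.smooth) x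
  have hanti := hDt.covDerivTensor_anticomm hJ hD x
  simp only [hDt.covDerivTensor_compTensor hJ hD, hC] at hanti ⊢
  exact sum_torsion_eq_neg_sum_complex (g := metricForm g x) (J := (J x).toLinearMap)
    (g.symm x) (hJ.skew x) he (hDt.differenceTensor_anticomm hJ x) hanti u v

end IsMinimalUnitary

end IntrinsicTorsion

end AlmostHermitian

theorem lemma3p7 {E : Type*} [NormedAddCommGroup E] [NormedSpace ℝ E] [FiniteDimensional ℝ E]
    (n : ℕ) (hE : Module.finrank ℝ E = 2 * n)
    {M : Type*} [TopologicalSpace M] [T2Space M] [ChartedSpace E M] [IsManifold 𝓘(ℝ, E) ∞ M]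
    (g : ContMDiffRiemannianMetric 𝓘(ℝ, E) ∞ E (fun x : M => TangentSpace 𝓘(ℝ, E) x))
    (J : ∀ x : M, TangentSpace 𝓘(ℝ, E) x →L[ℝ] TangentSpace 𝓘(ℝ, E) x)
    (hJ : IsAlmostHermitian g J)
    (D Dt : CovariantDerivative 𝓘(ℝ, E) E (TangentSpace 𝓘(ℝ, E) : M → Type _))
    (hD : IsLeviCivita g D) (hDt : IsMinimalUnitary g J D Dt)
    (ξ : ∀ x : M, TangentSpace 𝓘(ℝ, E) x →ₗ[ℝ] TangentSpace 𝓘(ℝ, E) x →ₗ[ℝ]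
      TangentSpace 𝓘(ℝ, E) x)
    (hξ : ξ = differenceTensor D Dt)
    (x : M) (e : Module.Basis (Fin (2 * n)) ℝ (TangentSpace 𝓘(ℝ, E) x))
    (he : IsOrthonormalBasis g e) (X Y : TangentSpace 𝓘(ℝ, E) x) :
    antiHermitianPart J (starRicci g J D e) X Y
        = ∑ i, g.inner x (covDerivTensor Dt ξ x (e i) (J x (e i)) (J x X)) Y
          - ∑ i, g.inner x (ξ x (J x (ξ x (e i) (e i))) (J x X)) Y ∧
    antiHermitianPart J (starRicci g J D e) X Y
        = -∑ i, g.inner x (covDerivTensor D (compTensor J ξ) x (e i) (J x (e i)) X) Y := by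
  subst hξ
  have h := hDt.antiHermitianPart_starRicci hJ hD he X Y
  exact ⟨h, h.trans (hDt.sum_covDerivTensor_sub_eq_neg_sum hJ hD.smooth he X Y)⟩
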